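/- Let $\nu\in\mathbb C$ with $\nu\notin\{0,-1,-2,\dots\}$, let $J_\nu(z)=\sum_{n\ge 0}\frac{(-1)^n(z/2)^{2n+\nu}}{n!\,\Gamma(\nu+n+1)}$ be the Bessel function of the first kind, and let $J_\nu'$ be its derivative with respect to $z$. Then $J_\nu'$ has infinitely many nontrivial (i.e. nonzero) zeros; as zeros of the even entire function $z^{1-\nu}J_\nu'(z)$ they occur in pairs $\pm j'_{\nu k}$, $k=1,2,\dots$, where the $j'_{\nu k}$ are the zeros with $-\pi/2<\arg z\le\pi/2$ (principal branch of $J_\nu$), each repeated according to its multiplicity. For every $n\ge 1$ the series $$\tau_n=\sum_{k=1}^\infty (j'_{\nu k})^{-2n}$$ converges absolutely, and $$\tau_1=\frac{\nu+2}{4\nu(\nu+1)},\qquad \tau_2=\frac{-4\nu^2\tau_1^2-4\nu\tau_1+1}{-4\nu^2(\nu+2)},\qquad \nu^2(\nu+3)\tau_3=(\nu+1)\tau_2+2\nu^2\tau_1\tau_2-\tau_1^2,$$ and, for every integer $k\ge 3$, $$-\nu^2(k+\nu+1)\tau_{k+1}=-(k+\nu-1)\tau_k-\nu^2\sum_{m=1}^{k}\tau_m\tau_{k-m+1}+\sum_{m=1}^{k-1}\tau_m\tau_{k-m}.$$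 In particular, $$\tau_2=\sum_{k=1}^\infty (j'_{\nu k})^{-4}=\frac{\nu^2+8\nu+8}{16\,\nu^2(\nu+1)^2(\nu+2)},\qquad \tau_3=\sum_{k=1}^\infty (j'_{\nu k})^{-6}=\frac{\nu^3+16\nu^2+38\nu+24}{32\,\nu^3(\nu+1)^3(\nu+2)(\nu+3)}.$$ -/

import Mathlib

/-- The Bessel function of the first kind,
`J_ν(z) = ∑ₙ (-1)ⁿ (z/2)^(2n+ν) / (n! Γ(ν+n+1))`, with the principal branch of the power.
It is holomorphic in `z` off the half-line `(-∞, 0]`. -/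
noncomputable def besselJ (ν z : ℂ) : ℂ :=
  ∑' n : ℕ, (-1) ^ n * (z / 2) ^ (2 * (n : ℂ) + ν)
    / ((n.factorial : ℂ) * Complex.Gamma (ν + n + 1))

/-- The derivative `J_ν'(z)` with respect to `z`. -/
noncomputable def besselJDeriv (ν z : ℂ) : ℂ :=
  deriv (besselJ ν) z

/-- The half-plane `-π/2 < arg z ≤ π/2`, `z ≠ 0`, which contains exactly one point of every pair
`±z` with `z ≠ 0`, and lies in the domain of holomorphy of `J_ν`. -/
def halfPlane : Set ℂ :=
  {z | 0 < z.re ∨ (z.re = 0 ∧ 0 < z.im)}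

/-- `j 0, j 1, j 2, …` lists the nontrivial zeros of `J_ν'` up to sign (one zero of every pair
`±z`), each one repeated according to its multiplicity. -/
structure IsBesselDerivZeroSeq (ν : ℂ) (j : ℕ → ℂ) : Prop where
  mem : ∀ k, j k ∈ halfPlane
  count : ∀ z ∈ halfPlane, {k | j k = z}.encard = analyticOrderAt (besselJDeriv ν) z

/-- The power sum `τ_n = ∑ₖ (j k)^(-2n)`. -/
noncomputable def rayleighTau (j : ℕ → ℂ) (n : ℕ) : ℂ :=
  ∑' k, ((j k) ^ (2 * n))⁻¹

/-!
With `x = z ^ 2`, `F(x) = 2 (z / 2) ^ (1 - ν) J_ν'(z)` is an entire function of order at most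
`1 / 2` which does not vanish at `0`, and its Taylor coefficients `(2 n + ν) bₙ`, where
`J_ν(z) = (z / 2) ^ ν ∑ₙ bₙ z ^ (2 n)`, are all nonzero. The squares of the nontrivial zeros of
`J_ν'`, one zero from each pair `±z`, are the zeros of `F`.

An entire function of order less than one with `F(0) ≠ 0` has absolutely summable reciprocal
zeros, and its logarithmic derivative is `∑ₖ 1 / (x - wₖ)`. Having finitely many zeros would make
it a polynomial, which the nonvanishing of the coefficients excludes. Expanding the logarithmic
derivative at `0` gives `x F' = -T F`, where `T = ∑ₙ τₙ xⁿ` is the generating series of the power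
sums.

In terms of `E(x) = (z / 2) ^ (-ν) J_ν(z)` and `θ = x d/dx`, the definition of `F` and Bessel's
equation read `F = ν E + 2 θ E` and `ν F + 2 θ F = (ν² - x) E`. Eliminating `E`, and substituting
`θ F = -T F`, leaves the Riccati equation
`(ν² - x) (4 (T² - θ T - ν T) + x) = x (4 T - 2 ν)`,
whose coefficients are the recurrences between the `τₙ`.
-/

open Filter Function Metric Set Topology
open PowerSeries (coeff constantCoeff X)
open scoped PowerSeries

section TaylorSeries

variable {𝕜 : Type*} [NontriviallyNormedField 𝕜] {f g : 𝕜 → 𝕜}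

/-- The Taylor series of `f` at the origin, as a formal power series. -/
noncomputable def taylorSeries (f : 𝕜 → 𝕜) : 𝕜⟦X⟧ :=
  PowerSeries.mk fun n => iteratedDeriv n f 0 / n.factorial

lemma coeff_taylorSeries (n : ℕ) :
    coeff n (taylorSeries f) = iteratedDeriv n f 0 / n.factorial :=
  PowerSeries.coeff_mk n _

lemma constantCoeff_taylorSeries : constantCoeff (taylorSeries f) = f 0 := by
  simp [← PowerSeries.coeff_zero_eq_constantCoeff_apply, coeff_taylorSeries]

lemma taylorSeries_congr (h : f =ᶠ[𝓝 0] g) : taylorSeries f = taylorSeries g := by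
  ext n
  rw [coeff_taylorSeries, coeff_taylorSeries, h.iteratedDeriv_eq]

lemma taylorSeries_const_smul (c : 𝕜) : taylorSeries (c • f) = c • taylorSeries f := by
  ext n
  simp only [PowerSeries.coeff_smul, coeff_taylorSeries, iteratedDeriv_const_smul_field,
    smul_eq_mul, mul_div_assoc]

lemma taylorSeries_deriv [CharZero 𝕜] :
    taylorSeries (deriv f) = d⁄dX 𝕜 (taylorSeries f) := by
  ext n
  rw [PowerSeries.coeff_derivative, coeff_taylorSeries, coeff_taylorSeries, iteratedDeriv_succ',
    Nat.factorial_succ]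
  push_cast
  field_simp

variable [CompleteSpace 𝕜]

lemma taylorSeries_add (hf : AnalyticAt 𝕜 f 0) (hg : AnalyticAt 𝕜 g 0) :
    taylorSeries (f + g) = taylorSeries f + taylorSeries g := by
  ext n
  simp only [map_add, coeff_taylorSeries, iteratedDeriv_add hf.contDiffAt hg.contDiffAt, add_div]

variable [CharZero 𝕜]

lemma taylorSeries_eq_of_hasSum {P : 𝕜⟦X⟧}
    (h : ∀ᶠ z in 𝓝 0, HasSum (fun n => coeff n P * z ^ n) (f z)) : taylorSeries f = P := by
  have hP : HasFPowerSeriesAt f (.ofScalars 𝕜 fun n => coeff n P) 0 := by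
    simpa [hasFPowerSeriesAt_iff, mul_comm] using h
  have hf := hP.eq_formalMultilinearSeries hP.analyticAt.hasFPowerSeriesAt
  ext n
  rw [coeff_taylorSeries]
  exact (congrFun (FormalMultilinearSeries.ofScalars_series_injective 𝕜 𝕜 hf) n).symm

lemma taylorSeries_mul (hf : AnalyticAt 𝕜 f 0) (hg : AnalyticAt 𝕜 g 0) :
    taylorSeries (f * g) = taylorSeries f * taylorSeries g := by
  ext n
  simp only [coeff_taylorSeries, PowerSeries.coeff_mul, Finset.sum_div,
    iteratedDeriv_mul hf.contDiffAt hg.contDiffAt,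
    Finset.Nat.sum_antidiagonal_eq_sum_range_succ_mk]
  refine Finset.sum_congr rfl fun i hi => ?_
  rw [Nat.cast_choose 𝕜 (Finset.mem_range_succ_iff.1 hi)]
  field_simp [Nat.factorial_ne_zero]

lemma taylorSeries_id : taylorSeries (id : 𝕜 → 𝕜) = X :=
  taylorSeries_eq_of_hasSum <| .of_forall fun z => by
    simpa [PowerSeries.coeff_X] using hasSum_single (f := fun n => coeff n (X : 𝕜⟦X⟧) * z ^ n) 1
      fun n hn => by simp [PowerSeries.coeff_X, hn]

lemma taylorSeries_polynomial_eval (p : Polynomial 𝕜) :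
    taylorSeries (fun z => p.eval z) = p := by
  refine taylorSeries_eq_of_hasSum (.of_forall fun z => ?_)
  rw [Polynomial.eval_eq_sum, Polynomial.sum_def]
  simpa only [Polynomial.coeff_coe] using
    hasSum_sum_of_ne_finset_zero (f := fun n => p.coeff n * z ^ n) (s := p.support)
    fun n hn => by rw [Polynomial.notMem_support_iff.1 hn, zero_mul]

end TaylorSeries

lemma hasSum_coeff_taylorSeries {f : ℂ → ℂ} (hf : Differentiable ℂ f) (z : ℂ) :
    HasSum (fun n => coeff n (taylorSeries f) * z ^ n) (f z) := by
  simpa [coeff_taylorSeries, div_eq_inv_mul, mul_assoc, mul_comm (z ^ _)] using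
    Complex.hasSum_taylorSeries_of_entire hf 0 z

section EulerDerivation

variable {R : Type*} [CommRing R]

/-- The Euler derivation `X · d/dX` of formal power series. -/
noncomputable def eulerDerivation (R : Type*) [CommRing R] : Derivation R R⟦X⟧ R⟦X⟧ :=
  (X : R⟦X⟧) • d⁄dX R

lemma coeff_eulerDerivation (P : R⟦X⟧) (n : ℕ) :
    coeff n (eulerDerivation R P) = n * coeff n P := by
  cases n with
  | zero => simp [eulerDerivation]
  | succ n =>
    rw [eulerDerivation, Derivation.smul_apply, smul_eq_mul, PowerSeries.coeff_succ_X_mul,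
      PowerSeries.coeff_derivative]
    push_cast
    ring

lemma eulerDerivation_X : eulerDerivation R X = X := by
  simp [eulerDerivation, PowerSeries.derivative_X]

end EulerDerivation

lemma taylorSeries_id_mul_deriv {𝕜 : Type*} [NontriviallyNormedField 𝕜] [CompleteSpace 𝕜]
    [CharZero 𝕜] {f : 𝕜 → 𝕜} (hf : AnalyticAt 𝕜 f 0) :
    taylorSeries (id * deriv f) = eulerDerivation 𝕜 (taylorSeries f) := by
  rw [taylorSeries_mul analyticAt_id hf.deriv, taylorSeries_id, taylorSeries_deriv]
  rfl

/-- The values `w k` with `k ∈ s` list the zeros of `f`, each one repeated according to its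
multiplicity. -/
def ListsZerosOn {ι : Type*} (f : ℂ → ℂ) (w : ι → ℂ) (s : Set ι) : Prop :=
  ∀ z, {k ∈ s | w k = z}.encard = analyticOrderAt f z

lemma analyticOrderAt_one_sub_div {a : ℂ} (ha : a ≠ 0) (z : ℂ) :
    analyticOrderAt (fun u => 1 - u / a) z = if a = z then 1 else 0 := by
  have han : AnalyticAt ℂ (fun u => 1 - u / a) z := by fun_prop
  split_ifs with h
  · subst h
    exact han.analyticOrderAt_eq_one_of_zero_deriv_ne_zero (by simp [ha]) (by simp [ha])
  · rw [han.analyticOrderAt_eq_zero, sub_ne_zero, ne_comm, Ne, div_eq_one_iff_eq ha]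
    exact fun h' => h h'.symm

lemma exists_eq_one_sub_div_mul_of_apply_eq_zero {f : ℂ → ℂ} (hf : Differentiable ℂ f) {a : ℂ}
    (ha : a ≠ 0) (hfa : f a = 0) :
    ∃ g : ℂ → ℂ, Differentiable ℂ g ∧ ∀ z, f z = (1 - z / a) * g z := by
  have hd : Differentiable ℂ (dslope f a) := by
    rw [← differentiableOn_univ] at hf ⊢
    exact (Complex.differentiableOn_dslope univ_mem).2 hf
  refine ⟨fun z => -a * dslope f a z, hd.const_mul _, fun z => ?_⟩
  have hslope : (z - a) * dslope f a z = f z := by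
    simpa [hfa] using sub_smul_dslope f a z
  rw [← hslope]
  field_simp
  ring

namespace ListsZerosOn

variable {ι κ : Type*} {f : ℂ → ℂ} {w : ι → ℂ} {s : Set ι}

lemma apply_eq_zero (hw : ListsZerosOn f w s) {k : ι} (hk : k ∈ s) : f (w k) = 0 := by
  apply apply_eq_zero_of_analyticOrderAt_ne_zero
  rw [← hw, Set.encard_ne_zero]
  exact ⟨k, hk, rfl⟩

lemma ne_zero (hw : ListsZerosOn f w s) (h0 : f 0 ≠ 0) {k : ι} (hk : k ∈ s) : w k ≠ 0 :=
  fun h => h0 (h ▸ hw.apply_eq_zero hk)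

lemma exists_pos_le_norm (hw : ListsZerosOn f w s) (hf : ContinuousAt f 0) (h0 : f 0 ≠ 0) :
    ∃ δ > 0, ∀ k ∈ s, δ ≤ ‖w k‖ := by
  obtain ⟨δ, hδ, hne⟩ := Metric.eventually_nhds_iff.1 (hf.eventually_ne h0)
  refine ⟨δ, hδ, fun k hk => ?_⟩
  by_contra! hlt
  exact hne (by simpa using hlt) (hw.apply_eq_zero hk)

lemma apply_ne_zero (hw : ListsZerosOn f w s) (hf : Differentiable ℂ f) {z : ℂ}
    (hz : ∀ k ∈ s, w k ≠ z) : f z ≠ 0 := by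
  rw [← (hf.analyticAt z).analyticOrderAt_eq_zero, ← hw z, encard_eq_zero]
  exact eq_empty_of_forall_notMem fun k hk => hz k hk.1 hk.2

lemma comp_equiv (hw : ListsZerosOn f w univ) (e : κ ≃ ι) : ListsZerosOn f (w ∘ e) univ := by
  intro z
  rw [← hw z, ← e.symm.injective.encard_image, e.symm.image_eq_preimage_symm]
  rfl

lemma exists_eq_one_sub_div_mul (hw : ListsZerosOn f w s) (hf : Differentiable ℂ f)
    (h0 : f 0 ≠ 0) {a : ι} (ha : a ∈ s) :
    ∃ g : ℂ → ℂ, Differentiable ℂ g ∧ (∀ z, f z = (1 - z / w a) * g z) ∧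
      ListsZerosOn g w (s \ {a}) := by
  have hwa := hw.ne_zero h0 ha
  obtain ⟨g, hg, hfg⟩ := exists_eq_one_sub_div_mul_of_apply_eq_zero hf hwa (hw.apply_eq_zero ha)
  refine ⟨g, hg, hfg, fun z => ?_⟩
  have hord : analyticOrderAt f z = (if w a = z then 1 else 0) + analyticOrderAt g z := by
    rw [← analyticOrderAt_one_sub_div hwa, ← analyticOrderAt_mul (by fun_prop) (hg.analyticAt z)]
    exact congrArg (analyticOrderAt · z) (funext hfg)
  rw [← hw z] at hord
  split_ifs at hord with haz
  · have hinsert : {k ∈ s | w k = z} = insert a {k ∈ s \ {a} | w k = z} := by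
      ext k; grind
    rw [hinsert, encard_insert_of_notMem (fun h => h.1.2 rfl), add_comm] at hord
    exact ENat.add_right_injective_of_ne_top ENat.one_ne_top hord
  · rw [zero_add] at hord
    rw [← hord]
    congr 1
    ext k; grind

lemma exists_eq_prod_mul (hw : ListsZerosOn f w s) (hf : Differentiable ℂ f) (h0 : f 0 ≠ 0)
    (S : Finset ι) (hS : (S : Set ι) ⊆ s) :
    ∃ g : ℂ → ℂ, Differentiable ℂ g ∧ (∀ z, f z = (∏ k ∈ S, (1 - z / w k)) * g z) ∧
      ListsZerosOn g w (s \ S) := by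
  classical
  induction S using Finset.induction_on with
  | empty => exact ⟨f, hf, by simp, by simpa using hw⟩
  | insert a S ha ih =>
    rw [Finset.coe_insert, insert_subset_iff] at hS
    obtain ⟨g, hg, hfg, hgw⟩ := ih hS.2
    have hg0 : g 0 ≠ 0 := by simpa [hfg 0] using h0
    obtain ⟨h, hh, hgh, hhw⟩ := hgw.exists_eq_one_sub_div_mul hg hg0 ⟨hS.1, ha⟩
    refine ⟨h, hh, fun z => ?_, ?_⟩
    · rw [hfg, hgh, Finset.prod_insert ha]
      ring
    · rwa [Finset.coe_insert, insert_eq, union_comm, ← sdiff_sdiff]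

end ListsZerosOn

lemma listsZerosOn_sigma_fst {f : ℂ → ℂ} (hf : ∀ z, analyticOrderAt f z ≠ ⊤) :
    ListsZerosOn f (Sigma.fst : (Σ z, Fin (analyticOrderNatAt f z)) → ℂ) univ := by
  intro z
  have hfiber : {k : Σ z, Fin (analyticOrderNatAt f z) | k ∈ univ ∧ k.1 = z} =
      range (Sigma.mk z) := by
    ext ⟨u, i⟩
    simp [eq_comm]
  rw [hfiber, ← image_univ, sigma_mk_injective.encard_image, encard_univ,
    ENat.card_eq_coe_fintype_card, Fintype.card_fin, Nat.cast_analyticOrderNatAt (hf z)]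

lemma analyticOrderAt_ne_top_of_apply_ne_zero {f : ℂ → ℂ} (hf : Differentiable ℂ f) {z₀ : ℂ}
    (h : f z₀ ≠ 0) (z : ℂ) : analyticOrderAt f z ≠ ⊤ := by
  rw [Ne, AnalyticOnNhd.analyticOrderAt_eq_top_iff_eq_zero z fun z => hf.analyticAt z]
  exact fun hf0 => h (congrFun hf0 z₀)

/-- Dividing by the zeros of modulus at most `R` gains a factor `e` for each of them, as
`|1 - z / w| ≥ 3 > e` on the circle `|z| = 4R`. -/
lemma exp_card_mul_norm_le_of_eq_prod_mul {ι : Type*} {f g : ℂ → ℂ} {w : ι → ℂ} {R M : ℝ}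
    (hR : 0 < R) {S : Finset ι} (hw0 : ∀ k ∈ S, w k ≠ 0) (hwR : ∀ k ∈ S, ‖w k‖ ≤ R)
    (hg : Differentiable ℂ g) (hfg : ∀ z, f z = (∏ k ∈ S, (1 - z / w k)) * g z)
    (hM : ∀ z, ‖z‖ = 4 * R → ‖f z‖ ≤ M) {z : ℂ} (hz : ‖z‖ ≤ 4 * R) :
    Real.exp S.card * ‖g z‖ ≤ M := by
  have hfactor : ∀ u, ‖u‖ = 4 * R → ∀ k ∈ S, Real.exp 1 ≤ ‖1 - u / w k‖ := by
    intro u hu k hk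
    have hquot : 4 ≤ ‖u / w k‖ := by
      rw [norm_div, hu, le_div_iff₀ (norm_pos_iff.2 (hw0 k hk))]
      linarith [hwR k hk]
    have htriangle := norm_sub_norm_le (u / w k) 1
    rw [norm_sub_rev, norm_one] at htriangle
    linarith [Real.exp_one_lt_three]
  rw [mul_comm, ← le_div_iff₀ (Real.exp_pos _)]
  refine Complex.norm_le_of_forall_mem_frontier_norm_le (U := ball 0 (4 * R)) isBounded_ball
    hg.diffContOnCl (fun u hu => ?_) ?_
  · rw [frontier_ball _ (by positivity), mem_sphere_zero_iff_norm] at hu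
    rw [le_div_iff₀ (Real.exp_pos _), mul_comm]
    calc Real.exp S.card * ‖g u‖ = (∏ _ ∈ S, Real.exp 1) * ‖g u‖ := by
          rw [Finset.prod_const, Real.exp_one_pow]
      _ ≤ (∏ k ∈ S, ‖1 - u / w k‖) * ‖g u‖ := by
          gcongr with _ hk
          exact hfactor u hu _ hk
      _ = ‖f u‖ := by rw [hfg, norm_mul, norm_prod]
      _ ≤ M := hM u hu
  · rw [closure_ball _ (by positivity)]
    simpa using hz

lemma logDeriv_prod_one_sub_div_mul {ι : Type*} {g : ℂ → ℂ} {w : ι → ℂ} {S : Finset ι}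
    {z : ℂ} (hw0 : ∀ k ∈ S, w k ≠ 0) (hwz : ∀ k ∈ S, w k ≠ z) (hg : DifferentiableAt ℂ g z)
    (hgz : g z ≠ 0) :
    logDeriv (fun u => (∏ k ∈ S, (1 - u / w k)) * g u) z =
      ∑ k ∈ S, (z - w k)⁻¹ + logDeriv g z := by
  have hfactor : ∀ k ∈ S, 1 - z / w k ≠ 0 := fun k hk => by
    rw [sub_ne_zero, ne_comm, Ne, div_eq_one_iff_eq (hw0 k hk)]
    exact (hwz k hk).symm
  rw [logDeriv_mul z (Finset.prod_ne_zero_iff.2 hfactor) hgz (by fun_prop) hg,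
    logDeriv_prod hfactor fun k _ => by fun_prop]
  congr 1
  refine Finset.sum_congr rfl fun k hk => ?_
  have hderiv : deriv (fun u => 1 - u / w k) z = -(w k)⁻¹ := by simp
  have hwk := hw0 k hk
  have hsub : z - w k ≠ 0 := sub_ne_zero.2 (hwz k hk).symm
  rw [logDeriv_apply, hderiv, div_eq_iff (hfactor k hk)]
  field_simp
  ring

section LogDeriv

variable {g : ℂ → ℂ} {R A : ℝ}

lemma exists_eq_mul_exp_of_ne_zero (hg : DifferentiableOn ℂ g (ball 0 R))
    (hne : ∀ z ∈ ball (0 : ℂ) R, g z ≠ 0) :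
    ∃ h : ℂ → ℂ, h 0 = 0 ∧ (∀ z ∈ ball (0 : ℂ) R, HasDerivAt h (logDeriv g z) z) ∧
      ∀ z ∈ ball (0 : ℂ) R, g z = g 0 * Complex.exp (h z) := by
  have hdiff : ∀ z ∈ ball (0 : ℂ) R, DifferentiableAt ℂ g z := fun z hz =>
    hg.differentiableAt (isOpen_ball.mem_nhds hz)
  have hlogDeriv : DifferentiableOn ℂ (logDeriv g) (ball 0 R) :=
    (hg.deriv isOpen_ball).div hg hne
  obtain ⟨h, h0, hh⟩ := hlogDeriv.isExactOn_ball.with_val_at 0 0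
  refine ⟨h, h0, hh, fun z hz => ?_⟩
  have hderiv : ∀ u ∈ ball (0 : ℂ) R, HasDerivAt (fun u => g u * Complex.exp (-h u)) 0 u := by
    intro u hu
    refine ((hdiff u hu).hasDerivAt.mul (hh u hu).neg.cexp).congr_deriv ?_
    rw [logDeriv_apply]
    field_simp [hne u hu]
    ring
  have hconst : g z * Complex.exp (-h z) = g 0 * Complex.exp (-h 0) :=
    isOpen_ball.is_const_of_deriv_eq_zero (convex_ball (0 : ℂ) R).isPreconnected
      (fun u hu => (hderiv u hu).differentiableAt.differentiableWithinAt)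
      (fun u hu => (hderiv u hu).deriv) hz (mem_ball_self (pos_of_mem_ball hz))
  rw [h0, neg_zero, Complex.exp_zero, mul_one] at hconst
  rw [← hconst, mul_assoc, ← Complex.exp_add, neg_add_cancel, Complex.exp_zero, mul_one]

/-- Borel–Carathéodory bounds the holomorphic logarithm of `g / g 0`, and Cauchy's estimate its
derivative. -/
lemma norm_logDeriv_le_of_ne_zero (hR : 0 < R) (hA : 0 < A)
    (hg : DifferentiableOn ℂ g (ball 0 R)) (hne : ∀ z ∈ ball (0 : ℂ) R, g z ≠ 0)
    (hgA : ∀ z ∈ ball (0 : ℂ) R, ‖g z‖ ≤ ‖g 0‖ * Real.exp A) {z : ℂ} (hz : ‖z‖ ≤ R / 4) :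
    ‖logDeriv g z‖ ≤ 8 * A / R := by
  obtain ⟨h, h0, hh, hexp⟩ := exists_eq_mul_exp_of_ne_zero hg hne
  have hdiff : DifferentiableOn ℂ h (ball 0 R) := fun u hu =>
    (hh u hu).differentiableAt.differentiableWithinAt
  have hre : MapsTo h (ball 0 R) {u | u.re ≤ A} := by
    intro u hu
    have hgu := hgA u hu
    rw [hexp u hu, norm_mul, Complex.norm_exp] at hgu
    simpa [hne 0 (mem_ball_self hR)] using hgu
  have hnorm : ∀ u : ℂ, ‖u‖ ≤ R / 2 → ‖h u‖ ≤ 2 * A := by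
    intro u hu
    refine (Complex.borelCaratheodory_zero hA hdiff hre hR
      (mem_ball_zero_iff.2 (by linarith)) h0).trans ?_
    rw [div_le_iff₀ (by linarith)]
    nlinarith
  have hball : ∀ u ∈ closedBall z (R / 4), ‖u‖ ≤ R / 2 := by
    intro u hu
    rw [mem_closedBall, dist_eq_norm] at hu
    linarith [norm_sub_norm_le u z]
  have hdiffz : DiffContOnCl ℂ h (ball z (R / 4)) := hdiff.diffContOnCl_ball fun u hu =>
    mem_ball_zero_iff.2 (by linarith [hball u hu])
  calc ‖logDeriv g z‖ = ‖deriv h z‖ := by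
        rw [(hh z (mem_ball_zero_iff.2 (by linarith))).deriv]
    _ ≤ 2 * A / (R / 4) := Complex.norm_deriv_le_of_forall_mem_sphere_norm_le (by positivity)
        hdiffz fun u hu => hnorm u (hball u (sphere_subset_closedBall hu))
    _ = 8 * A / R := by field_simp; norm_num

end LogDeriv

section Summability
open MeasureTheory

variable {ι : Type*} {a : ι → ℝ} {δ K ρ s : ℝ}

lemma rpow_neg_eq_integral_Ioi (hs : 0 < s) {x : ℝ} (hx : 0 < x) :
    x ^ (-s) = s * ∫ R in Ioi x, R ^ (-s - 1) := by
  rw [integral_Ioi_rpow_of_lt (by linarith) hx, sub_add_cancel]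
  field_simp

/-- Integrate the counting bound against `R ^ (-s - 1)`. -/
lemma summable_rpow_neg_of_card_le (hδ : 0 < δ) (hs : 0 < s) (hρ : ρ < s) (ha : ∀ k, δ ≤ a k)
    (hK : ∀ R, δ ≤ R → ∀ S : Finset ι, (∀ k ∈ S, a k ≤ R) → (S.card : ℝ) ≤ K * R ^ ρ) :
    Summable fun k => a k ^ (-s) := by
  classical
  have hpos : ∀ k, 0 < a k := fun k => hδ.trans_le (ha k)
  have hint : ∀ k, IntegrableOn (fun R => R ^ (-s - 1)) (Ioi (a k)) := fun k =>
    integrableOn_Ioi_rpow_of_lt (by linarith) (hpos k)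
  refine summable_of_sum_le (c := s * ∫ R in Ioi δ, K * R ^ (ρ - s - 1))
    (fun k => Real.rpow_nonneg (hpos k).le _) fun S => ?_
  have hind : ∀ k, ∫ R in Ioi (a k), R ^ (-s - 1) =
      ∫ R in Ioi δ, (Ioi (a k)).indicator (fun R => R ^ (-s - 1)) R := fun k => by
    rw [setIntegral_indicator measurableSet_Ioi, Ioi_inter_Ioi, sup_of_le_right (ha k)]
  have hint' : ∀ k ∈ S, IntegrableOn ((Ioi (a k)).indicator fun R => R ^ (-s - 1)) (Ioi δ) :=
    fun k _ => ((integrable_indicator_iff measurableSet_Ioi).2 (hint k)).integrableOn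
  calc ∑ k ∈ S, a k ^ (-s)
      = s * ∫ R in Ioi δ, ∑ k ∈ S, (Ioi (a k)).indicator (fun R => R ^ (-s - 1)) R := by
        rw [integral_finsetSum S hint', Finset.mul_sum]
        exact Finset.sum_congr rfl fun k _ => by rw [rpow_neg_eq_integral_Ioi hs (hpos k), hind k]
    _ ≤ s * ∫ R in Ioi δ, K * R ^ (ρ - s - 1) := by
        refine mul_le_mul_of_nonneg_left ?_ hs.le
        refine setIntegral_mono_on (integrable_finsetSum S hint')
          ((integrableOn_Ioi_rpow_of_lt (by linarith) hδ).const_mul K) measurableSet_Ioi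
          fun R hR => ?_
        have hR0 : 0 < R := hδ.trans hR
        simp only [indicator_apply, mem_Ioi, Finset.sum_ite, Finset.sum_const_zero, add_zero,
          Finset.sum_const, nsmul_eq_mul]
        calc ((S.filter fun k => a k < R).card : ℝ) * R ^ (-s - 1)
            ≤ K * R ^ ρ * R ^ (-s - 1) := by
              gcongr
              exact hK R hR.le _ fun k hk => (Finset.mem_filter.1 hk).2.le
          _ = K * R ^ (ρ - s - 1) := by
              rw [mul_assoc, ← Real.rpow_add hR0]
              ring_nf

end Summability

/-- Entire functions of order less than one: `log |f z| ≤ A + B |z| ^ ρ` for some `ρ < 1`. -/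
structure EntireOrderLTOne (f : ℂ → ℂ) : Prop where
  differentiable : Differentiable ℂ f
  exists_norm_le : ∃ ρ ∈ Ico (0 : ℝ) 1, ∃ A B : ℝ, 0 ≤ B ∧
    ∀ z, ‖f z‖ ≤ Real.exp (A + B * ‖z‖ ^ ρ)

lemma EntireOrderLTOne.exists_norm_le_norm_zero_mul_exp {f : ℂ → ℂ} (hf : EntireOrderLTOne f)
    (h0 : f 0 ≠ 0) :
    ∃ ρ ∈ Ico (0 : ℝ) 1, ∃ A B : ℝ, 0 < A ∧ 0 ≤ B ∧
      ∀ R z, ‖z‖ = 4 * R → ‖f z‖ ≤ ‖f 0‖ * Real.exp (A + B * R ^ ρ) := by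
  obtain ⟨ρ, hρ, A, B, hB, hgrowth⟩ := hf.exists_norm_le
  refine ⟨ρ, hρ, max 1 (A - Real.log ‖f 0‖), B * 4 ^ ρ, by positivity, by positivity,
    fun R z hz => (hgrowth z).trans ?_⟩
  have hR : 0 ≤ R := by linarith [norm_nonneg z]
  nth_rw 1 [← Real.exp_log (norm_pos_iff.2 h0)]
  rw [← Real.exp_add, Real.exp_le_exp, hz, Real.mul_rpow (by norm_num) hR, ← mul_assoc]
  linarith [le_max_right 1 (A - Real.log ‖f 0‖)]

lemma tendsto_norm_cofinite_atTop_of_summable_inv {ι E : Type*} [NormedAddCommGroup E]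
    {w : ι → E} (hw0 : ∀ k, w k ≠ 0) (hw : Summable fun k => ‖w k‖⁻¹) :
    Tendsto (fun k => ‖w k‖) cofinite atTop := by
  have hpos : Tendsto (fun k => ‖w k‖⁻¹) cofinite (𝓝[>] 0) :=
    tendsto_nhdsWithin_iff.2 ⟨hw.tendsto_cofinite_zero,
      .of_forall fun k => inv_pos.2 (norm_pos_iff.2 (hw0 k))⟩
  exact hpos.inv_tendsto_nhdsGT_zero.congr fun k => inv_inv _

lemma summable_inv_sub_of_summable_inv_norm {ι 𝕜 : Type*} [NormedField 𝕜] [CompleteSpace 𝕜]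
    {w : ι → 𝕜} (hw0 : ∀ k, w k ≠ 0) (hw : Summable fun k => ‖w k‖⁻¹) (z : 𝕜) :
    Summable fun k => (z - w k)⁻¹ := by
  refine (hw.mul_left 2).of_norm_bounded_eventually ?_
  filter_upwards [(tendsto_norm_cofinite_atTop_of_summable_inv hw0 hw).eventually_ge_atTop
    (2 * ‖z‖)] with k hk
  have hwk : 0 < ‖w k‖ := norm_pos_iff.2 (hw0 k)
  have htriangle := norm_sub_norm_le (w k) z
  calc ‖(z - w k)⁻¹‖ = ‖w k - z‖⁻¹ := by rw [norm_inv, norm_sub_rev]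
    _ ≤ (2⁻¹ * ‖w k‖)⁻¹ := by gcongr; linarith
    _ = 2 * ‖w k‖⁻¹ := by rw [mul_inv, inv_inv]

lemma tendsto_const_mul_add_rpow_div_atTop_zero (c A B : ℝ) {ρ : ℝ} (hρ : ρ < 1) :
    Tendsto (fun R : ℝ => c * (A + B * R ^ ρ) / R) atTop (𝓝 0) := by
  have hA := tendsto_inv_atTop_zero.const_mul (c * A)
  have hB := (tendsto_rpow_neg_atTop (sub_pos.2 hρ)).const_mul (c * B)
  rw [mul_zero] at hA hB
  refine (add_zero (0 : ℝ) ▸ hA.add hB).congr' ?_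
  filter_upwards [eventually_gt_atTop 0] with R hR
  rw [neg_sub, Real.rpow_sub_one hR.ne']
  ring

namespace ListsZerosOn

variable {ι : Type*} {f : ℂ → ℂ} {w : ι → ℂ}

section Disc

variable {s : Set ι} {S : Finset ι} {R A : ℝ}

lemma card_le (hw : ListsZerosOn f w s) (hf : Differentiable ℂ f) (h0 : f 0 ≠ 0) (hR : 0 < R)
    (hfA : ∀ z, ‖z‖ = 4 * R → ‖f z‖ ≤ ‖f 0‖ * Real.exp A) (hSs : (S : Set ι) ⊆ s)
    (hS : ∀ k ∈ S, ‖w k‖ ≤ R) : (S.card : ℝ) ≤ A := by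
  obtain ⟨g, hg, hfg, -⟩ := hw.exists_eq_prod_mul hf h0 S hSs
  have hg0 : f 0 = g 0 := by simp [hfg 0]
  have hexp := exp_card_mul_norm_le_of_eq_prod_mul hR (fun k hk => hw.ne_zero h0 (hSs hk)) hS hg
    hfg hfA (z := 0) (by simpa using hR.le)
  rw [hg0, mul_comm] at hexp
  exact Real.exp_le_exp.1 (le_of_mul_le_mul_left hexp (norm_pos_iff.2 (hg0 ▸ h0)))

lemma norm_logDeriv_sub_sum_le (hw : ListsZerosOn f w s) (hf : Differentiable ℂ f)
    (h0 : f 0 ≠ 0) (hR : 0 < R) (hA : 0 < A)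
    (hfA : ∀ z, ‖z‖ = 4 * R → ‖f z‖ ≤ ‖f 0‖ * Real.exp A)
    (hS : (S : Set ι) = {k ∈ s | ‖w k‖ ≤ R}) {z : ℂ} (hz : ‖z‖ ≤ R / 4) (hfz : f z ≠ 0) :
    ‖logDeriv f z - ∑ k ∈ S, (z - w k)⁻¹‖ ≤ 8 * A / R := by
  have hmem : ∀ k ∈ S, k ∈ s ∧ ‖w k‖ ≤ R := fun k hk => by
    rw [← Finset.mem_coe, hS] at hk
    exact hk
  have hw0 : ∀ k ∈ S, w k ≠ 0 := fun k hk => hw.ne_zero h0 (hmem k hk).1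
  obtain ⟨g, hg, hfg, hgw⟩ := hw.exists_eq_prod_mul hf h0 S fun k hk => (hmem k hk).1
  have hg0 : f 0 = g 0 := by simp [hfg 0]
  have hgz : g z ≠ 0 := right_ne_zero_of_mul (hfg z ▸ hfz)
  have hwz : ∀ k ∈ S, w k ≠ z := fun k hk h => hfz (h ▸ hw.apply_eq_zero (hmem k hk).1)
  rw [funext hfg, logDeriv_prod_one_sub_div_mul hw0 hwz (hg z) hgz, add_sub_cancel_left]
  refine norm_logDeriv_le_of_ne_zero hR hA hg.differentiableOn (fun u hu => ?_) (fun u hu => ?_) hz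
  · refine hgw.apply_ne_zero hg fun k hk hku => hk.2 ?_
    rw [hS]
    exact ⟨hk.1, hku ▸ (mem_ball_zero_iff.1 hu).le⟩
  · have hexp := exp_card_mul_norm_le_of_eq_prod_mul hR hw0 (fun k hk => (hmem k hk).2) hg hfg hfA
      (z := u) (by linarith [mem_ball_zero_iff.1 hu])
    rw [← hg0]
    exact (le_mul_of_one_le_left (norm_nonneg _) (Real.one_le_exp (by positivity))).trans hexp

end Disc

lemma summable_inv_norm (hw : ListsZerosOn f w univ) (hf : EntireOrderLTOne f) (h0 : f 0 ≠ 0) :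
    Summable fun k => ‖w k‖⁻¹ := by
  obtain ⟨δ, hδ, hle⟩ := hw.exists_pos_le_norm hf.differentiable.continuous.continuousAt h0
  obtain ⟨ρ, hρ, A, B, hA, _, hgrowth⟩ := hf.exists_norm_le_norm_zero_mul_exp h0
  simp only [← Real.rpow_neg_one]
  refine summable_rpow_neg_of_card_le (K := A / δ ^ ρ + B) hδ one_pos hρ.2 (fun k => hle k trivial)
    fun R hR S hS => ?_
  refine (hw.card_le hf.differentiable h0 (hδ.trans_le hR) (hgrowth R) (subset_univ _) hS).trans ?_
  rw [add_mul, div_mul_eq_mul_div, mul_div_assoc]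
  gcongr
  refine le_mul_of_one_le_right hA.le ?_
  rw [one_le_div (by positivity)]
  exact Real.rpow_le_rpow hδ.le hR hρ.1

lemma hasSum_logDeriv (hw : ListsZerosOn f w univ) (hf : EntireOrderLTOne f) (h0 : f 0 ≠ 0)
    {z : ℂ} (hfz : f z ≠ 0) : HasSum (fun k => (z - w k)⁻¹) (logDeriv f z) := by
  have hw0 : ∀ k, w k ≠ 0 := fun k => hw.ne_zero h0 trivial
  have hinv := hw.summable_inv_norm hf h0
  have hfin : ∀ R, {k | ‖w k‖ ≤ R}.Finite := fun R => by
    simpa [Filter.eventually_cofinite] using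
      (tendsto_norm_cofinite_atTop_of_summable_inv hw0 hinv).eventually_gt_atTop R
  have hdisc : Tendsto (fun R => (hfin R).toFinset) atTop atTop :=
    tendsto_atTop_finset_of_monotone
      (fun R R' hRR' k hk => by simpa using ((hfin R).mem_toFinset.1 hk).trans hRR')
      fun k => ⟨‖w k‖, by simp⟩
  obtain ⟨ρ, hρ, A, B, hA, hB, hgrowth⟩ := hf.exists_norm_le_norm_zero_mul_exp h0
  have hlim : Tendsto (fun R => logDeriv f z - ∑ k ∈ (hfin R).toFinset, (z - w k)⁻¹) atTop
      (𝓝 0) := by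
    refine squeeze_zero_norm' ?_ (tendsto_const_mul_add_rpow_div_atTop_zero 8 A B hρ.2)
    filter_upwards [eventually_gt_atTop 0, eventually_ge_atTop (4 * ‖z‖)] with R hR hzR
    exact hw.norm_logDeriv_sub_sum_le hf.differentiable h0 hR (by positivity) (hgrowth R)
      (by simp) (by linarith) hfz
  have hsum := (summable_inv_sub_of_summable_inv_norm hw0 hinv z).hasSum
  have hpartial : Tendsto (fun R => ∑ k ∈ (hfin R).toFinset, (z - w k)⁻¹) atTop
      (𝓝 (logDeriv f z)) := by
    simpa using (tendsto_const_nhds (x := logDeriv f z)).sub hlim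
  rwa [tendsto_nhds_unique (hsum.comp hdisc) hpartial] at hsum

lemma eq_apply_zero_mul_prod [Fintype ι] (hw : ListsZerosOn f w univ) (hf : EntireOrderLTOne f)
    (h0 : f 0 ≠ 0) (z : ℂ) : f z = f 0 * ∏ k, (1 - z / w k) := by
  obtain ⟨g, hg, hfg, hgw⟩ := hw.exists_eq_prod_mul hf.differentiable h0 Finset.univ
    (subset_univ _)
  have hg0 : f 0 = g 0 := by simp [hfg 0]
  have hgne : ∀ u, g u ≠ 0 := fun u => hgw.apply_ne_zero hg (by simp)
  have hderiv : deriv g =ᶠ[𝓝 0] 0 := by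
    filter_upwards [hf.differentiable.continuous.continuousAt.eventually_ne h0] with u hfu
    have hlog := hw.hasSum_logDeriv hf h0 hfu
    have hlog' := logDeriv_prod_one_sub_div_mul (S := Finset.univ)
      (fun k _ => hw.ne_zero h0 (mem_univ k))
      (fun k _ hku => hfu (by rw [← hku, hw.apply_eq_zero (mem_univ k)])) (hg u) (hgne u)
    rw [← funext hfg, ← hlog.tsum_eq, tsum_fintype, left_eq_add, logDeriv_apply,
      div_eq_zero_iff] at hlog'
    exact hlog'.resolve_right (hgne u)
  have hderiv0 : deriv g = 0 := AnalyticOnNhd.eq_of_eventuallyEq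
    (fun u _ => (hg.analyticAt u).deriv) (fun u _ => analyticAt_const) hderiv
  rw [hfg, is_const_of_deriv_eq_zero hg (congrFun hderiv0) z 0, hg0, mul_comm]

lemma infinite_of_forall_ne_polynomial (hw : ListsZerosOn f w univ) (hf : EntireOrderLTOne f)
    (h0 : f 0 ≠ 0) (hpoly : ∀ p : Polynomial ℂ, f ≠ fun z => p.eval z) : Infinite ι := by
  by_contra hfin
  rw [not_infinite_iff_finite] at hfin
  have := Fintype.ofFinite ι
  refine hpoly (.C (f 0) * ∏ k, (1 - .C (w k)⁻¹ * .X)) (funext fun z => ?_)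
  rw [hw.eq_apply_zero_mul_prod hf h0 z]
  simp [Polynomial.eval_prod, div_eq_inv_mul]

lemma countable (hw : ListsZerosOn f w univ) (hf : EntireOrderLTOne f) (h0 : f 0 ≠ 0) :
    Countable ι := by
  have hsupport : support (fun k => ‖w k‖⁻¹) = univ :=
    eq_univ_of_forall fun k => by simpa using hw.ne_zero h0 (mem_univ k)
  exact countable_univ_iff.1 (hsupport ▸ (hw.summable_inv_norm hf h0).countable_support)

end ListsZerosOn

lemma EntireOrderLTOne.exists_listsZerosOn_nat {f : ℂ → ℂ} (hf : EntireOrderLTOne f)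
    (h0 : f 0 ≠ 0) (hpoly : ∀ p : Polynomial ℂ, f ≠ fun z => p.eval z) :
    ∃ w : ℕ → ℂ, ListsZerosOn f w univ := by
  have hw := listsZerosOn_sigma_fst
    (analyticOrderAt_ne_top_of_apply_ne_zero hf.differentiable h0)
  have := hw.infinite_of_forall_ne_polynomial hf h0 hpoly
  have := hw.countable hf h0
  obtain ⟨e⟩ : Nonempty (ℕ ≃ Σ z, Fin (analyticOrderNatAt f z)) := nonempty_equiv_of_countable
  exact ⟨_, hw.comp_equiv e⟩

section PowerSums

variable {ι 𝕜 : Type*} [NormedField 𝕜] {w : ι → 𝕜}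

/-- The generating series `∑ n ≥ 1, p n * X ^ n` of the power sums `p n = ∑ k, (w k) ^ (-n)`. It has
no constant term, so that the divergent `p 0` does not enter. -/
noncomputable def powerSumSeries (w : ι → 𝕜) : 𝕜⟦X⟧ :=
  PowerSeries.mk fun n => if n = 0 then 0 else ∑' k, (w k ^ n)⁻¹

lemma coeff_powerSumSeries {n : ℕ} (hn : n ≠ 0) :
    coeff n (powerSumSeries w) = ∑' k, (w k ^ n)⁻¹ := by
  rw [powerSumSeries, PowerSeries.coeff_mk, if_neg hn]

lemma constantCoeff_powerSumSeries : constantCoeff (powerSumSeries w) = 0 := by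
  rw [← PowerSeries.coeff_zero_eq_constantCoeff_apply, powerSumSeries, PowerSeries.coeff_mk,
    if_pos rfl]

variable [CompleteSpace 𝕜]

lemma summable_inv_pow_of_summable_inv_norm (hw0 : ∀ k, w k ≠ 0)
    (hw : Summable fun k => ‖w k‖⁻¹) {n : ℕ} (hn : n ≠ 0) :
    Summable fun k => (w k ^ n)⁻¹ := by
  refine hw.of_norm_bounded_eventually ?_
  filter_upwards [(tendsto_norm_cofinite_atTop_of_summable_inv hw0 hw).eventually_ge_atTop 1]
    with k hk
  rw [norm_inv, norm_pow]
  exact inv_anti₀ (norm_pos_iff.2 (hw0 k)) (le_self_pow₀ hk hn)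

lemma hasSum_coeff_powerSumSeries (hw : Summable fun k => ‖w k‖⁻¹) {δ : ℝ}
    (hδ : ∀ k, δ ≤ ‖w k‖) {z : 𝕜} (hz : ‖z‖ < δ) :
    HasSum (fun n => coeff n (powerSumSeries w) * z ^ n) (∑' k, z / (w k - z)) := by
  have hδ0 : 0 < δ := (norm_nonneg z).trans_lt hz
  have hw0 : ∀ k, w k ≠ 0 := fun k => norm_pos_iff.1 (hδ0.trans_le (hδ k))
  have hquot : ∀ k, ‖z / w k‖ ≤ ‖z‖ / δ := fun k => by
    rw [norm_div]
    gcongr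
    exact hδ k
  have hlt : ‖z‖ / δ < 1 := (div_lt_one hδ0).2 hz
  have hprod : Summable fun p : ι × ℕ => (z / w p.1) ^ (p.2 + 1) := by
    refine ((hw.mul_left ‖z‖).mul_of_nonneg (summable_geometric_of_lt_one (by positivity) hlt)
      (fun k => by positivity) fun n => by positivity).of_norm_bounded fun p => ?_
    rw [norm_pow, pow_succ']
    gcongr
    · rw [norm_div, div_eq_mul_inv]
    · exact hquot p.1
  have hrow : ∀ k, HasSum (fun n : ℕ => (z / w k) ^ (n + 1)) (z / (w k - z)) := fun k => by
    have hgeom := (hasSum_geometric_of_norm_lt_one ((hquot k).trans_lt hlt)).mul_left (z / w k)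
    rw [one_sub_div (hw0 k), inv_div, div_mul_div_cancel₀ (hw0 k)] at hgeom
    simpa only [← pow_succ'] using hgeom
  have hcol : ∀ n : ℕ, HasSum (fun k => (z / w k) ^ (n + 1))
      (coeff (n + 1) (powerSumSeries w) * z ^ (n + 1)) := fun n => by
    rw [coeff_powerSumSeries n.succ_ne_zero, mul_comm]
    simpa only [div_pow, div_eq_mul_inv _ (w _ ^ _)] using
      (summable_inv_pow_of_summable_inv_norm hw0 hw n.succ_ne_zero).hasSum.mul_left _
  rw [(hprod.hasSum.prod_fiberwise hrow).tsum_eq, ← hasSum_nat_add_iff' 1]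
  simpa [constantCoeff_powerSumSeries] using
    ((Equiv.prodComm ℕ ι).hasSum_iff.2 hprod.hasSum).prod_fiberwise hcol

end PowerSums

namespace ListsZerosOn

variable {ι : Type*} {f : ℂ → ℂ} {w : ι → ℂ}

lemma taylorSeries_id_mul_logDeriv (hw : ListsZerosOn f w univ) (hf : EntireOrderLTOne f)
    (h0 : f 0 ≠ 0) : taylorSeries (id * logDeriv f) = -powerSumSeries w := by
  have hcont := hf.differentiable.continuous.continuousAt (x := 0)
  obtain ⟨δ, hδ, hle⟩ := hw.exists_pos_le_norm hcont h0
  refine taylorSeries_eq_of_hasSum ?_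
  filter_upwards [hcont.eventually_ne h0, ball_mem_nhds 0 hδ] with z hfz hz
  have hterm : ∀ k, z / (w k - z) = -(z * (z - w k)⁻¹) := fun k => by
    rw [← neg_sub z, div_neg, div_eq_mul_inv]
  have hsum : ∑' k, z / (w k - z) = -(z * logDeriv f z) := by
    simp only [hterm, ← (hw.hasSum_logDeriv hf h0 hfz).tsum_eq, tsum_neg, tsum_mul_left]
  simpa [hsum] using (hasSum_coeff_powerSumSeries (hw.summable_inv_norm hf h0)
    (fun k => hle k (mem_univ k)) (mem_ball_zero_iff.1 hz)).neg

/-- Newton's identities, as an identity of generating series. -/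
lemma eulerDerivation_taylorSeries (hw : ListsZerosOn f w univ) (hf : EntireOrderLTOne f)
    (h0 : f 0 ≠ 0) :
    eulerDerivation ℂ (taylorSeries f) = -(powerSumSeries w * taylorSeries f) := by
  have han := hf.differentiable.analyticAt 0
  have hlog : AnalyticAt ℂ (logDeriv f) 0 := han.deriv.div han h0
  have hlogDeriv : id * deriv f =ᶠ[𝓝 0] (id * logDeriv f) * f := by
    filter_upwards [han.continuousAt.eventually_ne h0] with z hfz
    simp only [Pi.mul_apply, logDeriv_apply]
    field_simp
  rw [← taylorSeries_id_mul_deriv han, taylorSeries_congr hlogDeriv,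
    taylorSeries_mul (analyticAt_id.mul hlog) han, hw.taylorSeries_id_mul_logDeriv hf h0, neg_mul]

end ListsZerosOn

section CoefficientGrowth

lemma norm_le_of_sq_mul_norm_succ_le {E : Type*} [SeminormedAddCommGroup E] {a : ℕ → E} {K : ℝ}
    (hK : 0 ≤ K) (ha : ∀ n : ℕ, (n + 1) ^ 2 * ‖a (n + 1)‖ ≤ K * ‖a n‖) (n : ℕ) :
    ‖a n‖ ≤ ‖a 0‖ * (K ^ n / n.factorial ^ 2) := by
  induction n with
  | zero => simp
  | succ n ih =>
    calc ‖a (n + 1)‖ ≤ K * ‖a n‖ / (n + 1) ^ 2 := by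
          rw [le_div_iff₀' (by positivity)]
          exact ha n
      _ ≤ K * (‖a 0‖ * (K ^ n / n.factorial ^ 2)) / (n + 1) ^ 2 := by gcongr
      _ = ‖a 0‖ * (K ^ (n + 1) / (n + 1).factorial ^ 2) := by
          rw [Nat.factorial_succ]
          push_cast
          field_simp
          ring

variable {a : ℕ → ℂ} {C D : ℝ}

/-- With `r = √(D |z|)`, the `n`-th term is at most `C (r ^ n / n!) ^ 2`, and
`r ^ n / n! ≤ e ^ r`. -/
lemma norm_mul_pow_le (hD : 0 ≤ D) (ha : ∀ n, ‖a n‖ ≤ C * (D ^ n / n.factorial ^ 2)) (z : ℂ)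
    (n : ℕ) :
    ‖a n * z ^ n‖ ≤ C * Real.exp √(D * ‖z‖) * (√(D * ‖z‖) ^ n / n.factorial) := by
  have hC : 0 ≤ C := by simpa using (norm_nonneg _).trans (ha 0)
  calc ‖a n * z ^ n‖ ≤ C * (D ^ n / n.factorial ^ 2) * ‖z‖ ^ n := by
        rw [norm_mul, norm_pow]
        gcongr
        exact ha n
    _ = C * (√(D * ‖z‖) ^ n / n.factorial) * (√(D * ‖z‖) ^ n / n.factorial) := by
        have hsq : √(D * ‖z‖) ^ n * √(D * ‖z‖) ^ n = D ^ n * ‖z‖ ^ n := by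
          rw [← mul_pow, Real.mul_self_sqrt (by positivity), mul_pow]
        linear_combination -(C / n.factorial ^ 2) * hsq
    _ ≤ C * Real.exp √(D * ‖z‖) * (√(D * ‖z‖) ^ n / n.factorial) := by
        gcongr
        exact Real.pow_div_factorial_le_exp _ (Real.sqrt_nonneg _) n

lemma summable_mul_pow_of_norm_le (hD : 0 ≤ D)
    (ha : ∀ n, ‖a n‖ ≤ C * (D ^ n / n.factorial ^ 2)) (z : ℂ) : Summable fun n => a n * z ^ n :=
  .of_norm_bounded ((Real.summable_pow_div_factorial _).mul_left _) (norm_mul_pow_le hD ha z)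

lemma differentiable_tsum_mul_pow (hD : 0 ≤ D)
    (ha : ∀ n, ‖a n‖ ≤ C * (D ^ n / n.factorial ^ 2)) :
    Differentiable ℂ fun z => ∑' n, a n * z ^ n := by
  have hC : 0 ≤ C := by simpa using (norm_nonneg _).trans (ha 0)
  intro z
  have hdisc : DifferentiableOn ℂ (fun z => ∑' n, a n * z ^ n) (ball 0 (‖z‖ + 1)) := by
    refine Complex.differentiableOn_tsum_of_summable_norm
      ((Real.summable_pow_div_factorial √(D * (‖z‖ + 1))).mul_left
        (C * Real.exp √(D * (‖z‖ + 1)))) (fun n => by fun_prop)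
      isOpen_ball fun n u hu => (norm_mul_pow_le hD ha u n).trans ?_
    rw [mem_ball_zero_iff] at hu
    gcongr
  exact hdisc.differentiableAt (isOpen_ball.mem_nhds (by simp))

lemma entireOrderLTOne_of_norm_coeff_taylorSeries_le {f : ℂ → ℂ} (hf : Differentiable ℂ f)
    (hD : 0 ≤ D) (ha : ∀ n, ‖coeff n (taylorSeries f)‖ ≤ C * (D ^ n / n.factorial ^ 2)) :
    EntireOrderLTOne f := by
  refine ⟨hf, 1 / 2, by norm_num, C, 2 * √D, by positivity, fun z => ?_⟩
  have hexp := (NormedSpace.expSeries_div_hasSum_exp √(D * ‖z‖)).mul_left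
    (C * Real.exp √(D * ‖z‖))
  rw [← Real.exp_eq_exp_ℝ] at hexp
  rw [← (hasSum_coeff_taylorSeries hf z).tsum_eq]
  calc ‖∑' n, coeff n (taylorSeries f) * z ^ n‖
      ≤ C * Real.exp √(D * ‖z‖) * Real.exp √(D * ‖z‖) :=
        tsum_of_norm_bounded hexp (norm_mul_pow_le hD ha z)
    _ ≤ Real.exp C * Real.exp √(D * ‖z‖) * Real.exp √(D * ‖z‖) := by
        gcongr
        linarith [Real.add_one_le_exp C]
    _ = Real.exp (C + 2 * √D * ‖z‖ ^ (1 / 2 : ℝ)) := by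
        rw [← Real.exp_add, ← Real.exp_add, ← Real.sqrt_eq_rpow, Real.sqrt_mul hD]
        ring_nf

end CoefficientGrowth

/-- The Taylor coefficients of the entire function `x ↦ (z / 2) ^ (-ν) * J_ν(z)` of `x = z ^ 2`. -/
noncomputable def besselCoeff (ν : ℂ) (n : ℕ) : ℂ :=
  (-1) ^ n / (4 ^ n * n.factorial * Complex.Gamma (ν + n + 1))

/-- The entire function `x ↦ (z / 2) ^ (-ν) * J_ν(z)` of `x = z ^ 2`. -/
noncomputable def besselEntire (ν x : ℂ) : ℂ :=
  ∑' n, besselCoeff ν n * x ^ n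

/-- The entire function `x ↦ 2 * (z / 2) ^ (1 - ν) * J_ν'(z)` of `x = z ^ 2`. It is written in terms
of `besselEntire ν` by means of `z * d/dz = 2 * x * d/dx`. -/
noncomputable def besselDerivEntire (ν : ℂ) : ℂ → ℂ :=
  ν • besselEntire ν + (2 : ℂ) • (id * deriv (besselEntire ν))

lemma besselJ_eq (ν : ℂ) {z : ℂ} (hz : z ≠ 0) :
    besselJ ν z = (z / 2) ^ ν * besselEntire ν (z ^ 2) := by
  rw [besselJ, besselEntire, ← tsum_mul_left]
  refine tsum_congr fun n => ?_
  have hcast : 2 * (n : ℂ) = (2 * n : ℕ) := by push_cast; rfl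
  rw [Complex.cpow_add _ _ (div_ne_zero hz two_ne_zero), hcast, Complex.cpow_natCast, besselCoeff,
    div_pow, pow_mul 2, ← pow_mul z]
  norm_num
  ring

lemma halfPlane_subset_slitPlane : halfPlane ⊆ Complex.slitPlane := by
  rintro z (h | ⟨-, h⟩)
  · exact Or.inl h
  · exact Or.inr h.ne'

lemma bijOn_sq_halfPlane : BijOn (· ^ 2 : ℂ → ℂ) halfPlane {0}ᶜ := by
  refine ⟨fun z hz => ?_, fun z hz s hs h => ?_, fun x hx => ?_⟩
  · exact pow_ne_zero 2 (Complex.slitPlane_ne_zero (halfPlane_subset_slitPlane hz))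
  · refine (sq_eq_sq_iff_eq_or_eq_neg.1 h).resolve_right ?_
    rintro rfl
    simp only [halfPlane, Set.mem_ofPred_eq, Complex.neg_re, Complex.neg_im] at hz hs
    grind
  · obtain ⟨s, rfl⟩ := IsAlgClosed.exists_pow_nat_eq x two_pos
    have hs : s ∈ halfPlane ∨ -s ∈ halfPlane := by
      have hs0 : s.re ≠ 0 ∨ s.im ≠ 0 := by
        by_contra! h
        exact hx (by simp [show s = 0 from Complex.ext h.1 h.2])
      simp only [halfPlane, Set.mem_ofPred_eq, Complex.neg_re, Complex.neg_im]
      grind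
    exact hs.elim (fun h => ⟨s, h, rfl⟩) fun h => ⟨-s, h, neg_sq s⟩

section Bessel

variable {ν : ℂ} (hν : ∀ n : ℕ, ν ≠ -(n : ℂ))
include hν

lemma add_natCast_ne_zero_of_ne_neg_natCast (n : ℕ) : ν + n ≠ 0 :=
  fun h => hν n (eq_neg_of_add_eq_zero_left h)

lemma gamma_add_natCast_ne_zero (n : ℕ) : Complex.Gamma (ν + n) ≠ 0 :=
  Complex.Gamma_ne_zero fun m hm => hν (n + m) (by push_cast; linear_combination hm)

lemma besselCoeff_ne_zero (n : ℕ) : besselCoeff ν n ≠ 0 := by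
  have hΓ := gamma_add_natCast_ne_zero hν (n + 1)
  push_cast [← add_assoc] at hΓ
  simp [besselCoeff, hΓ, n.factorial_ne_zero]

lemma besselCoeff_succ (n : ℕ) :
    4 * (n + 1) * (ν + n + 1) * besselCoeff ν (n + 1) = -besselCoeff ν n := by
  have hνn := add_natCast_ne_zero_of_ne_neg_natCast hν (n + 1)
  have hΓ := gamma_add_natCast_ne_zero hν (n + 1)
  push_cast [← add_assoc] at hνn hΓ
  have hn : (n : ℂ) + 1 ≠ 0 := Nat.cast_add_one_ne_zero n
  have hfac : (n.factorial : ℂ) ≠ 0 := Nat.cast_ne_zero.2 n.factorial_ne_zero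
  rw [besselCoeff, besselCoeff, Nat.cast_succ, ← add_assoc, Complex.Gamma_add_one _ hνn,
    Nat.factorial_succ]
  push_cast
  field_simp
  ring

lemma exists_natCast_le_mul_norm_add : ∃ K : ℝ, 0 ≤ K ∧ ∀ n : ℕ, n ≤ K * ‖ν + n‖ := by
  obtain ⟨K, hK⟩ := (tendsto_natCast_div_add_atTop ν).norm.bddAbove_range
  have hle : ∀ n : ℕ, ‖(n : ℂ) / (n + ν)‖ ≤ K := fun n => hK ⟨n, rfl⟩
  refine ⟨K, (norm_nonneg _).trans (hle 0), fun n => ?_⟩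
  have hpos : 0 < ‖ν + n‖ := norm_pos_iff.2 (add_natCast_ne_zero_of_ne_neg_natCast hν n)
  simpa [add_comm, div_le_iff₀ hpos] using hle n

lemma exists_norm_besselCoeff_le :
    ∃ C D : ℝ, 0 ≤ D ∧ ∀ n, ‖besselCoeff ν n‖ ≤ C * (D ^ n / n.factorial ^ 2) := by
  obtain ⟨K, hK0, hK⟩ := exists_natCast_le_mul_norm_add hν
  refine ⟨_, K / 4, by positivity, norm_le_of_sq_mul_norm_succ_le (by positivity) fun n => ?_⟩
  have hrec : 4 * ((n : ℝ) + 1) * ‖ν + n + 1‖ * ‖besselCoeff ν (n + 1)‖ = ‖besselCoeff ν n‖ := by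
    have hcast : ‖(n : ℂ) + 1‖ = n + 1 := by exact_mod_cast Complex.norm_natCast (n + 1)
    simpa [hcast] using congrArg norm (besselCoeff_succ hν n)
  have hKn : (n : ℝ) + 1 ≤ K * ‖ν + n + 1‖ := by simpa [add_assoc] using hK (n + 1)
  calc ((n : ℝ) + 1) ^ 2 * ‖besselCoeff ν (n + 1)‖
      = (n + 1) * ((n + 1) * ‖besselCoeff ν (n + 1)‖) := by ring
    _ ≤ K * ‖ν + n + 1‖ * ((n + 1) * ‖besselCoeff ν (n + 1)‖) := by gcongr
    _ = K / 4 * ‖besselCoeff ν n‖ := by rw [← hrec]; ring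

lemma differentiable_besselEntire : Differentiable ℂ (besselEntire ν) := by
  obtain ⟨C, D, hD, hb⟩ := exists_norm_besselCoeff_le hν
  exact differentiable_tsum_mul_pow hD hb

lemma taylorSeries_besselEntire : taylorSeries (besselEntire ν) = .mk (besselCoeff ν) := by
  obtain ⟨C, D, hD, hb⟩ := exists_norm_besselCoeff_le hν
  refine taylorSeries_eq_of_hasSum (.of_forall fun x => ?_)
  simpa only [PowerSeries.coeff_mk, besselEntire] using
    (summable_mul_pow_of_norm_le hD hb x).hasSum

lemma differentiable_besselDerivEntire : Differentiable ℂ (besselDerivEntire ν) :=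
  have hE := differentiable_besselEntire hν
  (hE.const_smul ν).add ((differentiable_id.mul hE.deriv).const_smul 2)

lemma taylorSeries_besselDerivEntire :
    taylorSeries (besselDerivEntire ν) = ν • taylorSeries (besselEntire ν) +
      (2 : ℂ) • eulerDerivation ℂ (taylorSeries (besselEntire ν)) := by
  have hE := (differentiable_besselEntire hν).analyticAt 0
  rw [besselDerivEntire, taylorSeries_add (hE.const_smul (c := ν))
    ((analyticAt_id.mul hE.deriv).const_smul (c := (2 : ℂ))), taylorSeries_const_smul,
    taylorSeries_const_smul, taylorSeries_id_mul_deriv hE]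

lemma coeff_taylorSeries_besselDerivEntire (n : ℕ) :
    coeff n (taylorSeries (besselDerivEntire ν)) = (ν + (2 * n : ℕ)) * besselCoeff ν n := by
  rw [taylorSeries_besselDerivEntire hν, map_add, PowerSeries.coeff_smul, PowerSeries.coeff_smul,
    coeff_eulerDerivation, taylorSeries_besselEntire hν, PowerSeries.coeff_mk]
  push_cast
  ring

lemma coeff_taylorSeries_besselDerivEntire_ne_zero (n : ℕ) :
    coeff n (taylorSeries (besselDerivEntire ν)) ≠ 0 := by
  rw [coeff_taylorSeries_besselDerivEntire hν]
  exact mul_ne_zero (add_natCast_ne_zero_of_ne_neg_natCast hν _) (besselCoeff_ne_zero hν n)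

lemma besselDerivEntire_zero_ne_zero : besselDerivEntire ν 0 ≠ 0 := by
  rw [← constantCoeff_taylorSeries (f := besselDerivEntire ν),
    ← PowerSeries.coeff_zero_eq_constantCoeff_apply]
  exact coeff_taylorSeries_besselDerivEntire_ne_zero hν 0

lemma besselDerivEntire_ne_polynomial (p : Polynomial ℂ) :
    besselDerivEntire ν ≠ fun x => p.eval x := fun h => by
  refine coeff_taylorSeries_besselDerivEntire_ne_zero hν (p.natDegree + 1) ?_
  rw [h, taylorSeries_polynomial_eval, Polynomial.coeff_coe,
    Polynomial.coeff_eq_zero_of_natDegree_lt p.natDegree.lt_succ_self]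

lemma entireOrderLTOne_besselDerivEntire : EntireOrderLTOne (besselDerivEntire ν) := by
  obtain ⟨C, D, hD, hb⟩ := exists_norm_besselCoeff_le hν
  refine entireOrderLTOne_of_norm_coeff_taylorSeries_le (C := (‖ν‖ + 2) * C) (D := 2 * D)
    (differentiable_besselDerivEntire hν) (by positivity) fun n => ?_
  have hlin : ‖ν + (2 * n : ℕ)‖ ≤ (‖ν‖ + 2) * 2 ^ n := by
    have hn : (n : ℝ) ≤ 2 ^ n := by exact_mod_cast n.lt_two_pow_self.le
    have h1 : (1 : ℝ) ≤ 2 ^ n := one_le_pow₀ one_le_two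
    calc ‖ν + (2 * n : ℕ)‖ ≤ ‖ν‖ + 2 * n := by
          simpa using norm_add_le ν ((2 * n : ℕ) : ℂ)
      _ ≤ ‖ν‖ * 2 ^ n + 2 * 2 ^ n := by gcongr; exact le_mul_of_one_le_right (norm_nonneg ν) h1
      _ = (‖ν‖ + 2) * 2 ^ n := by ring
  calc ‖coeff n (taylorSeries (besselDerivEntire ν))‖
      = ‖ν + (2 * n : ℕ)‖ * ‖besselCoeff ν n‖ := by
        rw [coeff_taylorSeries_besselDerivEntire hν, norm_mul]
    _ ≤ (‖ν‖ + 2) * 2 ^ n * (C * (D ^ n / n.factorial ^ 2)) := by gcongr; exact hb n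
    _ = (‖ν‖ + 2) * C * ((2 * D) ^ n / n.factorial ^ 2) := by rw [mul_pow]; ring

lemma besselJDeriv_eq {z : ℂ} (hz : z ∈ Complex.slitPlane) :
    besselJDeriv ν z = (z / 2) ^ (ν - 1) / 2 * besselDerivEntire ν (z ^ 2) := by
  have hz0 : z ≠ 0 := Complex.slitPlane_ne_zero hz
  have hz2 : z / 2 ∈ Complex.slitPlane := by simpa [Complex.mem_slitPlane_iff] using hz
  have hJ : besselJ ν =ᶠ[𝓝 z] fun u => (u / 2) ^ ν * besselEntire ν (u ^ 2) := by
    filter_upwards [isOpen_ne.mem_nhds hz0] with u hu using besselJ_eq ν hu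
  have hpow : HasDerivAt (fun u : ℂ => (u / 2) ^ ν) (ν * (z / 2) ^ (ν - 1) * (1 / 2)) z :=
    ((hasDerivAt_id z).div_const 2).cpow_const hz2
  have hE : HasDerivAt (fun u : ℂ => besselEntire ν (u ^ 2))
      (deriv (besselEntire ν) (z ^ 2) * (2 * z)) z := by
    simpa [Function.comp_def] using
      (differentiable_besselEntire hν (z ^ 2)).hasDerivAt.comp z (hasDerivAt_pow 2 z)
  have hsub : (z / 2) ^ ν = (z / 2) ^ (ν - 1) * (z / 2) := by
    have hz20 := div_ne_zero hz0 two_ne_zero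
    rw [Complex.cpow_sub _ _ hz20, Complex.cpow_one, div_mul_cancel₀ _ hz20]
  rw [besselJDeriv, hJ.deriv_eq, (hpow.fun_mul hE).deriv, hsub]
  simp only [besselDerivEntire, Pi.add_apply, Pi.smul_apply, Pi.mul_apply, id, smul_eq_mul]
  ring

lemma analyticOrderAt_besselJDeriv {z : ℂ} (hz : z ∈ Complex.slitPlane) :
    analyticOrderAt (besselJDeriv ν) z = analyticOrderAt (besselDerivEntire ν) (z ^ 2) := by
  have hz0 : z ≠ 0 := Complex.slitPlane_ne_zero hz
  have hz2 : z / 2 ∈ Complex.slitPlane := by simpa [Complex.mem_slitPlane_iff] using hz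
  have hJ : besselJDeriv ν =ᶠ[𝓝 z]
      (fun u => (u / 2) ^ (ν - 1) / 2) * (besselDerivEntire ν ∘ fun u => u ^ 2) := by
    filter_upwards [Complex.isOpen_slitPlane.mem_nhds hz] with u hu using besselJDeriv_eq hν hu
  have hpow : AnalyticAt ℂ (fun u : ℂ => (u / 2) ^ (ν - 1) / 2) z :=
    ((analyticAt_id.div analyticAt_const two_ne_zero).cpow analyticAt_const hz2).div
      analyticAt_const two_ne_zero
  have hpow0 : (z / 2) ^ (ν - 1) / 2 ≠ 0 := by simp [Complex.cpow_eq_zero_iff, hz0]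
  have hF : AnalyticAt ℂ (besselDerivEntire ν ∘ fun u => u ^ 2) z :=
    ((differentiable_besselDerivEntire hν).comp (differentiable_id.pow 2)).analyticAt z
  rw [analyticOrderAt_congr hJ, analyticOrderAt_mul hpow hF, hpow.analyticOrderAt_eq_zero.2 hpow0,
    zero_add, analyticOrderAt_comp_of_deriv_ne_zero (analyticAt_id.pow 2) (by simp [hz0])]

end Bessel

section Riccati

/-- `U = a - 2 * T` satisfies `U * A = (a ^ 2 - x) * B`; differentiating this and eliminating `B`
leaves a multiple of `A`. -/
lemma riccati_of_derivation {R S : Type*} [CommRing R] [CommRing S] [NoZeroDivisors S] [Algebra R S]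
    (D : Derivation R S S) {a x A B T : S} (ha : D a = 0) (hx : D x = x)
    (hA : A = a * B + 2 * D B) (hDA : a * A + 2 * D A = (a ^ 2 - x) * B) (hT : D A = -(T * A))
    (hA0 : A ≠ 0) :
    (a ^ 2 - x) * (4 * (T ^ 2 - D T - a * T) + x) = x * (4 * T - 2 * a) := by
  have hU : (a - 2 * T) * A = (a ^ 2 - x) * B := by linear_combination hDA - 2 * hT
  have hDU : (a - 2 * T) * D A - 2 * D T * A = (a ^ 2 - x) * D B - x * B := by
    have h2 : D 2 = 0 := mod_cast D.map_natCast 2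
    have h := congrArg D hU
    simp only [Derivation.leibniz, map_sub, Derivation.leibniz_pow, ha, hx, h2, smul_eq_mul,
      smul_zero, mul_zero, add_zero, zero_sub] at h
    linear_combination h
  refine mul_right_cancel₀ hA0 ?_
  linear_combination (a ^ 2 - x) * (2 * hDU - 2 * (a - 2 * T) * hT - (a ^ 2 - x) * hA + a * hU) +
    2 * x * hU

variable {R : Type*} [CommRing R]

lemma coeff_of_riccati {ν : R} {T : R⟦X⟧}
    (h : (PowerSeries.C ν ^ 2 - X) *
      (4 * (T ^ 2 - eulerDerivation R T - PowerSeries.C ν * T) + X) =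
        X * (4 * T - 2 * PowerSeries.C ν)) (k : ℕ) :
    ν ^ 2 * (4 * (coeff (k + 1) (T ^ 2) - (k + 1 + ν) * coeff (k + 1) T) + coeff (k + 1) X) -
        (4 * (coeff k (T ^ 2) - (k + ν) * coeff k T) + coeff k X) =
      4 * coeff k T - 2 * coeff k (PowerSeries.C ν) := by
  have h4 (n : ℕ) (P : R⟦X⟧) : coeff n (4 * P) = 4 * coeff n P := by
    rw [← map_ofNat PowerSeries.C 4, PowerSeries.coeff_C_mul]
  have h2 (n : ℕ) (P : R⟦X⟧) : coeff n (2 * P) = 2 * coeff n P := by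
    rw [← map_ofNat PowerSeries.C 2, PowerSeries.coeff_C_mul]
  have hcoeff (n : ℕ) : coeff n (4 * (T ^ 2 - eulerDerivation R T - PowerSeries.C ν * T) + X) =
      4 * (coeff n (T ^ 2) - (n + ν) * coeff n T) + coeff n X := by
    rw [map_add, h4, map_sub, map_sub, coeff_eulerDerivation, PowerSeries.coeff_C_mul]
    ring
  have hk := congrArg (coeff (k + 1)) h
  rw [sub_mul, map_sub, ← map_pow, PowerSeries.coeff_C_mul, PowerSeries.coeff_succ_X_mul,
    PowerSeries.coeff_succ_X_mul, map_sub, h4, h2, hcoeff, hcoeff] at hk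
  exact_mod_cast hk

lemma coeff_sq_eq_sum_Icc {P : R⟦X⟧} (h0 : constantCoeff P = 0) (n : ℕ) :
    coeff n (P ^ 2) = ∑ m ∈ Finset.Icc 1 (n - 1), coeff m P * coeff (n - m) P := by
  rw [← PowerSeries.coeff_zero_eq_constantCoeff_apply] at h0
  rw [sq, PowerSeries.coeff_mul, Finset.Nat.sum_antidiagonal_eq_sum_range_succ_mk]
  refine (Finset.sum_subset (fun m hm => ?_) fun m hm hm' => ?_).symm
  · simp only [Finset.mem_Icc, Finset.mem_range] at hm ⊢
    omega
  · obtain rfl | rfl : m = 0 ∨ m = n := by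
      simp only [Finset.mem_Icc, Finset.mem_range] at hm hm'
      omega
    all_goals simp [h0]

end Riccati

section Bessel

variable {ν : ℂ} (hν : ∀ n : ℕ, ν ≠ -(n : ℂ))
include hν

lemma eulerDerivation_taylorSeries_besselDerivEntire :
    PowerSeries.C ν * taylorSeries (besselDerivEntire ν) +
        2 * eulerDerivation ℂ (taylorSeries (besselDerivEntire ν)) =
      (PowerSeries.C ν ^ 2 - X) * taylorSeries (besselEntire ν) := by
  ext n
  rw [two_mul, map_add, map_add, PowerSeries.coeff_C_mul, coeff_eulerDerivation,
    coeff_taylorSeries_besselDerivEntire hν, sub_mul, map_sub, ← map_pow, PowerSeries.coeff_C_mul,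
    taylorSeries_besselEntire hν, PowerSeries.coeff_mk]
  cases n with
  | zero => simp [sq, mul_assoc]
  | succ n =>
    rw [PowerSeries.coeff_succ_X_mul, PowerSeries.coeff_mk]
    push_cast
    linear_combination besselCoeff_succ hν n

lemma isBesselDerivZeroSeq_iff {j : ℕ → ℂ} :
    IsBesselDerivZeroSeq ν j ↔ (∀ k, j k ∈ halfPlane) ∧
      ListsZerosOn (besselDerivEntire ν) (fun k => j k ^ 2) univ := by
  have hcount (hj : ∀ k, j k ∈ halfPlane) {z : ℂ} (hz : z ∈ halfPlane) :
      {k | k ∈ univ ∧ j k ^ 2 = z ^ 2} = {k | j k = z} := by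
    ext k
    simpa using bijOn_sq_halfPlane.injOn.eq_iff (hj k) hz
  refine ⟨fun hj => ⟨hj.mem, fun x => ?_⟩, fun ⟨hmem, hw⟩ => ⟨hmem, fun z hz => ?_⟩⟩
  · rcases eq_or_ne x 0 with rfl | hx
    · rw [((differentiable_besselDerivEntire hν).analyticAt 0).analyticOrderAt_eq_zero.2
        (besselDerivEntire_zero_ne_zero hν), encard_eq_zero]
      exact eq_empty_of_forall_notMem fun k hk => bijOn_sq_halfPlane.mapsTo (hj.mem k) hk.2
    · obtain ⟨z, hz, rfl⟩ := bijOn_sq_halfPlane.surjOn hx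
      rw [← analyticOrderAt_besselJDeriv hν (halfPlane_subset_slitPlane hz), ← hj.count z hz]
      exact congrArg encard (hcount hj.mem hz)
  · rw [analyticOrderAt_besselJDeriv hν (halfPlane_subset_slitPlane hz), ← hw, hcount hmem hz]

lemma exists_isBesselDerivZeroSeq : ∃ j : ℕ → ℂ, IsBesselDerivZeroSeq ν j := by
  have h0 := besselDerivEntire_zero_ne_zero hν
  obtain ⟨w, hw⟩ := (entireOrderLTOne_besselDerivEntire hν).exists_listsZerosOn_nat h0
    (besselDerivEntire_ne_polynomial hν)
  choose j hj hjw using fun k => bijOn_sq_halfPlane.surjOn (hw.ne_zero h0 (mem_univ k))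
  obtain rfl : (fun k => j k ^ 2) = w := funext hjw
  exact ⟨j, (isBesselDerivZeroSeq_iff hν).2 ⟨hj, hw⟩⟩

end Bessel

lemma coeff_powerSumSeries_sq (j : ℕ → ℂ) {n : ℕ} (hn : n ≠ 0) :
    coeff n (powerSumSeries fun k => j k ^ 2) = rayleighTau j n := by
  simp only [coeff_powerSumSeries hn, rayleighTau, pow_mul]

lemma coeff_sq_powerSumSeries_sq (j : ℕ → ℂ) (n : ℕ) :
    coeff n ((powerSumSeries fun k => j k ^ 2) ^ 2) =
      ∑ m ∈ Finset.Icc 1 (n - 1), rayleighTau j m * rayleighTau j (n - m) := by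
  rw [coeff_sq_eq_sum_Icc constantCoeff_powerSumSeries]
  refine Finset.sum_congr rfl fun m hm => ?_
  rw [Finset.mem_Icc] at hm
  rw [coeff_powerSumSeries_sq j (by omega), coeff_powerSumSeries_sq j (by omega)]

namespace IsBesselDerivZeroSeq

variable {ν : ℂ} (hν : ∀ n : ℕ, ν ≠ -(n : ℂ)) {j : ℕ → ℂ} (hj : IsBesselDerivZeroSeq ν j)
include hν hj

lemma summable_inv_pow {n : ℕ} (hn : n ≠ 0) : Summable fun k => (j k ^ (2 * n))⁻¹ := by
  have hw := ((isBesselDerivZeroSeq_iff hν).1 hj).2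
  have h0 := besselDerivEntire_zero_ne_zero hν
  simpa only [pow_mul] using summable_inv_pow_of_summable_inv_norm
    (fun k => hw.ne_zero h0 (mem_univ k))
    (hw.summable_inv_norm (entireOrderLTOne_besselDerivEntire hν) h0) hn

lemma powerSumSeries_riccati :
    (PowerSeries.C ν ^ 2 - X) *
      (4 * ((powerSumSeries fun k => j k ^ 2) ^ 2 -
        eulerDerivation ℂ (powerSumSeries fun k => j k ^ 2) -
          PowerSeries.C ν * powerSumSeries fun k => j k ^ 2) + X) =
      X * (4 * (powerSumSeries fun k => j k ^ 2) - 2 * PowerSeries.C ν) := by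
  have hw := ((isBesselDerivZeroSeq_iff hν).1 hj).2
  refine riccati_of_derivation (eulerDerivation ℂ) (A := taylorSeries (besselDerivEntire ν))
    (B := taylorSeries (besselEntire ν)) ((eulerDerivation ℂ).map_algebraMap ν) eulerDerivation_X ?_
    (eulerDerivation_taylorSeries_besselDerivEntire hν)
    (hw.eulerDerivation_taylorSeries (entireOrderLTOne_besselDerivEntire hν)
      (besselDerivEntire_zero_ne_zero hν)) fun h => ?_
  · rw [taylorSeries_besselDerivEntire hν, PowerSeries.smul_eq_C_mul, PowerSeries.smul_eq_C_mul,
      map_ofNat]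
  · exact coeff_taylorSeries_besselDerivEntire_ne_zero hν 0 (by rw [h, map_zero])

lemma rayleighTau_one : rayleighTau j 1 = (ν + 2) / (4 * (ν + 1) * ν) := by
  have hν0 : ν ≠ 0 := by simpa using hν 0
  have hν1 : ν + 1 ≠ 0 := by simpa using add_natCast_ne_zero_of_ne_neg_natCast hν 1
  have h : ν ^ 2 * (-(4 * ((1 + ν) * rayleighTau j 1)) + 1) = -(2 * ν) := by
    simpa [coeff_sq_powerSumSeries_sq, coeff_powerSumSeries_sq j one_ne_zero,
      constantCoeff_powerSumSeries] using coeff_of_riccati (hj.powerSumSeries_riccati hν) 0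
  rw [eq_div_iff (by simp [hν0, hν1])]
  refine mul_left_cancel₀ hν0 ?_
  linear_combination -h

lemma rayleighTau_two_eq_rayleighTau_one :
    rayleighTau j 2 = (-4 * ν ^ 2 * rayleighTau j 1 ^ 2 - 4 * ν * rayleighTau j 1 + 1) /
      (-4 * ν ^ 2 * (ν + 2)) := by
  have hν0 : ν ≠ 0 := by simpa using hν 0
  have hν2 : ν + 2 ≠ 0 := by simpa using add_natCast_ne_zero_of_ne_neg_natCast hν 2
  have h : ν ^ 2 * (4 * (rayleighTau j 1 * rayleighTau j 1 - (1 + 1 + ν) * rayleighTau j 2)) -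
      (-(4 * ((1 + ν) * rayleighTau j 1)) + 1) = 4 * rayleighTau j 1 := by
    simpa [coeff_sq_powerSumSeries_sq, coeff_powerSumSeries_sq j, PowerSeries.coeff_X] using
      coeff_of_riccati (hj.powerSumSeries_riccati hν) 1
  rw [eq_div_iff (by simp [hν0, hν2])]
  linear_combination h

lemma neg_mul_rayleighTau_succ {k : ℕ} (hk : 2 ≤ k) :
    -ν ^ 2 * (k + ν + 1) * rayleighTau j (k + 1) =
      -(k + ν - 1) * rayleighTau j k
        - ν ^ 2 * ∑ m ∈ Finset.Icc 1 k, rayleighTau j m * rayleighTau j (k - m + 1)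
        + ∑ m ∈ Finset.Icc 1 (k - 1), rayleighTau j m * rayleighTau j (k - m) := by
  have h := coeff_of_riccati (hj.powerSumSeries_riccati hν) k
  rw [coeff_sq_powerSumSeries_sq, coeff_sq_powerSumSeries_sq, Nat.add_sub_cancel,
    coeff_powerSumSeries_sq j k.succ_ne_zero, coeff_powerSumSeries_sq j (by omega),
    PowerSeries.coeff_X, PowerSeries.coeff_X, PowerSeries.coeff_C, if_neg (by omega),
    if_neg (by omega), if_neg (by omega)] at h
  have hsum : ∑ m ∈ Finset.Icc 1 k, rayleighTau j m * rayleighTau j (k - m + 1) =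
      ∑ m ∈ Finset.Icc 1 k, rayleighTau j m * rayleighTau j (k + 1 - m) :=
    Finset.sum_congr rfl fun m hm => by rw [Nat.sub_add_comm (Finset.mem_Icc.1 hm).2]
  rw [hsum]
  linear_combination h / 4

lemma mul_rayleighTau_three :
    ν ^ 2 * (ν + 3) * rayleighTau j 3 = (ν + 1) * rayleighTau j 2 +
      2 * ν ^ 2 * rayleighTau j 1 * rayleighTau j 2 - rayleighTau j 1 ^ 2 := by
  have h : -ν ^ 2 * (2 + ν + 1) * rayleighTau j 3 = -(2 + ν - 1) * rayleighTau j 2 -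
      ν ^ 2 * (rayleighTau j 1 * rayleighTau j 2 + rayleighTau j 2 * rayleighTau j 1) +
        rayleighTau j 1 * rayleighTau j 1 := by
    simpa [Finset.sum_Icc_succ_top] using hj.neg_mul_rayleighTau_succ hν le_rfl
  linear_combination -h

lemma rayleighTau_two :
    rayleighTau j 2 = (ν ^ 2 + 8 * ν + 8) / (16 * ν ^ 2 * (ν + 1) ^ 2 * (ν + 2)) := by
  have hν0 : ν ≠ 0 := by simpa using hν 0
  have hν1 : ν + 1 ≠ 0 := by simpa using add_natCast_ne_zero_of_ne_neg_natCast hν 1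
  have hν2 : ν + 2 ≠ 0 := by simpa using add_natCast_ne_zero_of_ne_neg_natCast hν 2
  rw [hj.rayleighTau_two_eq_rayleighTau_one hν, hj.rayleighTau_one hν]
  field_simp
  ring

lemma rayleighTau_three :
    rayleighTau j 3 = (ν ^ 3 + 16 * ν ^ 2 + 38 * ν + 24) /
      (32 * ν ^ 3 * (ν + 1) ^ 3 * (ν + 2) * (ν + 3)) := by
  have hν0 : ν ≠ 0 := by simpa using hν 0
  have hν1 : ν + 1 ≠ 0 := by simpa using add_natCast_ne_zero_of_ne_neg_natCast hν 1
  have hν2 : ν + 2 ≠ 0 := by simpa using add_natCast_ne_zero_of_ne_neg_natCast hν 2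
  have hν3 : ν + 3 ≠ 0 := by simpa using add_natCast_ne_zero_of_ne_neg_natCast hν 3
  refine mul_left_cancel₀ (mul_ne_zero (pow_ne_zero 2 hν0) hν3) ?_
  rw [hj.mul_rayleighTau_three hν, hj.rayleighTau_two hν, hj.rayleighTau_one hν]
  field_simp
  ring

end IsBesselDerivZeroSeq

theorem mainTheorem3 (ν : ℂ) (hν : ∀ n : ℕ, ν ≠ -(n : ℂ)) :
    (∃ j : ℕ → ℂ, IsBesselDerivZeroSeq ν j) ∧
    ∀ j : ℕ → ℂ, IsBesselDerivZeroSeq ν j →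
      (∀ n : ℕ, 1 ≤ n → Summable (fun k => ((j k) ^ (2 * n))⁻¹)) ∧
      rayleighTau j 1 = (ν + 2) / (4 * (ν + 1) * ν) ∧
      rayleighTau j 2 =
        (-4 * ν ^ 2 * rayleighTau j 1 ^ 2 - 4 * ν * rayleighTau j 1 + 1)
          / (-4 * ν ^ 2 * (ν + 2)) ∧
      ν ^ 2 * (ν + 3) * rayleighTau j 3 =
        (ν + 1) * rayleighTau j 2 + 2 * ν ^ 2 * rayleighTau j 1 * rayleighTau j 2
          - rayleighTau j 1 ^ 2 ∧
      (∀ k : ℕ, 3 ≤ k →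
        -ν ^ 2 * (k + ν + 1) * rayleighTau j (k + 1) =
          -(k + ν - 1) * rayleighTau j k
            - ν ^ 2 * ∑ m ∈ Finset.Icc 1 k, rayleighTau j m * rayleighTau j (k - m + 1)
            + ∑ m ∈ Finset.Icc 1 (k - 1), rayleighTau j m * rayleighTau j (k - m)) ∧
      rayleighTau j 2 =
        (ν ^ 2 + 8 * ν + 8) / (16 * ν ^ 2 * (ν + 1) ^ 2 * (ν + 2)) ∧
      rayleighTau j 3 =
        (ν ^ 3 + 16 * ν ^ 2 + 38 * ν + 24)
          / (32 * ν ^ 3 * (ν + 1) ^ 3 * (ν + 2) * (ν + 3)) := by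
  refine ⟨exists_isBesselDerivZeroSeq hν, fun j hj => ⟨?_, ?_, ?_, ?_, ?_, ?_, ?_⟩⟩
  · exact fun n hn => hj.summable_inv_pow hν (Nat.one_le_iff_ne_zero.1 hn)
  · exact hj.rayleighTau_one hν
  · exact hj.rayleighTau_two_eq_rayleighTau_one hν
  · exact hj.mul_rayleighTau_three hν
  · exact fun k hk => hj.neg_mul_rayleighTau_succ hν (Nat.le_of_succ_le hk)
  · exact hj.rayleighTau_two hν
  · exact hj.rayleighTau_three hν
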